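/- Conventions. For a submonoid $M\subset\mathbb Z^d$ let $U(M)=M\cap(-M)$. A set $H$ is a system of generators of $M$ modulo $U(M)$ if $M=\mathbb Z_+H+U(M)$; it is a Hilbert basis of $M$ if it is minimal (under inclusion) with this property. An element $y\in M$ reduces $x\in M$ in $M$ if $y\notin U(M)$, $x\ne y$ and $x-y\in M$. An auto-reduction of $E\subset M$ in $M$ is a subset $E'\subset E$ such that $E'\cap U(M)=\emptyset$, no element of $E'$ is reduced by another one, and every $x\in E\setminus E'$ is in $U(M)$ or is reduced by some element of $E'$. Let $C\subset\mathbb R^d$ be a rational cone (the intersection of finitely many linear halfspaces given by linear forms with rational coefficients; not necessarily pointed or full-dimensional), $M=C\cap\mathbb Z^d$, $B$ a Hilbert basis of $M$, and $\lambda$ an integral linear form on $\mathbb Z^d$. Put $M^+=\{x\in M:\lambda(x)\ge 0\}$ and $M^-=\{x\in M:\lambda(x)\le 0\}$. Sets $B_i^+,B_i^-$ and $B_i=B_i^+\cup B_i^-$ $(i\ge 0)$ are constructed as follows. (1) If $\lambda$ vanishes on $U(M)$, let $B_0=B$. Otherwise choose a $\mathbb Z$-basis of $U(M^+)$ and an element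 $h\in U(M)$ with $\lambda(h)\ge 0$ that supplements it to a $\mathbb Z$-basis of $U(M)$ (so that $\lambda(h)>0$), and let $B_0$ consist of $h$, $-h$, the elements $x-\lfloor\lambda(x)/\lambda(h)\rfloor h$ for $x\in B$ with $\lambda(x)\ge 0$, and the elements $x+\lfloor-\lambda(x)/\lambda(h)\rfloor h$ for $x\in B$ with $\lambda(x)\le 0$. In both cases $B_0^+=\{x\in B_0:\lambda(x)\ge 0\}$ and $B_0^-=\{x\in B_0:\lambda(x)\le 0\}$. (2) For $i\ge 1$ let $\tilde B_i=B_{i-1}\cup\{x+y: x,y\in B_{i-1},\ \lambda(x)>0,\ \lambda(y)<0,\ x+y\ne 0\}$; let $B_i^+$ be an auto-reduction of $\{x\in\tilde B_i:\lambda(x)\ge 0\}$ in $M^+$ and $B_i^-$ an auto-reduction of $\{x\in\tilde B_i:\lambda(x)\le 0\}$ in $M^-$. Then, for every choice of $h$ and of the auto-reductions: (i) Suppose that new sums are tested against the old elements, that is, for all $i\ge1$ no element of $B_i^+\setminus B_{i-1}$ is reduced in $M^+$ by an element of $B_{i-1}^+$, and no element of $B_i^-\setminus B_{i-1}$ is reduced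 in $M^-$ by an element of $B_{i-1}^-$. Then there exists an $i\ge 1$ with $B_i=B_{i-1}$. (ii) Whenever $B_i=B_{i-1}$ for some $i\ge 1$, the set $B_i^+$ is a Hilbert basis of $M^+$ and $B_i^-$ is a Hilbert basis of $M^-$. -/

import Mathlib

namespace HalfspaceCut

/-- A rational cone in `ℝ^d`: the intersection of finitely many halfspaces given by linear forms
with rational coefficients. -/
def IsRationalCone {d : ℕ} (C : PointedCone ℝ (Fin d → ℝ)) : Prop :=
  ∃ S : Finset (Fin d → ℚ), ∀ x : Fin d → ℝ, x ∈ C ↔ ∀ a ∈ S, 0 ≤ ∑ i, (a i : ℝ) * x i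

/-- The monoid `C ∩ ℤ^d`. -/
def latticePoints {d : ℕ} (C : PointedCone ℝ (Fin d → ℝ)) : AddSubmonoid (Fin d → ℤ) :=
  C.toAddSubmonoid.comap ((Int.castAddHom ℝ).compLeft (Fin d))

section Monoids

variable {G : Type*} [AddCommGroup G]

/-- The unit group `U(M) = M ∩ -M` of a submonoid `M` of an abelian group. -/
abbrev units (M : AddSubmonoid G) : AddSubgroup G := M.support

/-- `H` is a system of generators of `M` modulo `U(M)`: `M = ℤ₊ H + U(M)`. -/
def GeneratesModUnits (M : AddSubmonoid G) (H : Set G) : Prop :=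
  AddSubmonoid.closure H ⊔ (units M).toAddSubmonoid = M

/-- A Hilbert basis of `M`: a system of generators modulo `U(M)` that is minimal with respect to
inclusion. -/
def IsHilbertBasis (M : AddSubmonoid G) (H : Set G) : Prop :=
  Minimal (GeneratesModUnits M) H

/-- `y` reduces `x` in `M`. -/
def Reduces (M : AddSubmonoid G) (y x : G) : Prop :=
  y ∉ units M ∧ x ≠ y ∧ x - y ∈ M

/-- `E'` is an auto-reduction of `E` in `M`: a possible outcome of removing all units from `E` and
then discarding elements that are reduced by another remaining element until no element is reduced
by another one. Thus `E' ⊆ E` contains no units, no element of `E'` is reduced by another one, and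
every discarded element is a unit or is reduced by an element that has been kept. -/
structure IsAutoReduction (M : AddSubmonoid G) (E E' : Set G) : Prop where
  subset : E' ⊆ E
  not_unit : ∀ x ∈ E', x ∉ units M
  not_reduced : ∀ x ∈ E', ∀ y ∈ E', ¬ Reduces M y x
  discarded : ∀ x ∈ E, x ∉ E' → x ∈ units M ∨ ∃ y ∈ E', Reduces M y x

/-- The family `b` is a `ℤ`-basis of the subgroup `U`. -/
def IsZBasis (U : AddSubgroup G) {n : ℕ} (b : Fin n → G) : Prop :=
  LinearIndependent ℤ b ∧ AddSubgroup.closure (Set.range b) = U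

/-- `M⁺ = M ∩ {lam ≥ 0}`. -/
def cutPos (M : AddSubmonoid G) (lam : G →ₗ[ℤ] ℤ) : AddSubmonoid G where
  carrier := {x | x ∈ M ∧ 0 ≤ lam x}
  zero_mem' := ⟨M.zero_mem, by simp⟩
  add_mem' := fun hx hy => ⟨M.add_mem hx.1 hy.1, by
    rw [map_add]; exact add_nonneg hx.2 hy.2⟩

/-- `M⁻ = M ∩ {lam ≤ 0}`. -/
def cutNeg (M : AddSubmonoid G) (lam : G →ₗ[ℤ] ℤ) : AddSubmonoid G where
  carrier := {x | x ∈ M ∧ lam x ≤ 0}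
  zero_mem' := ⟨M.zero_mem, by simp⟩
  add_mem' := fun hx hy => ⟨M.add_mem hx.1 hy.1, by
    rw [map_add]; exact add_nonpos hx.2 hy.2⟩

/-- The element that replaces `x` in the set `B₀` in the case where `lam` does not vanish on the
units: `x - a h` with `a = ⌊lam x / lam h⌋` if `lam x ≥ 0`, and `x - a (-h)` with
`a = ⌊lam (-x) / lam h⌋` if `lam x ≤ 0`
(for `lam x = 0` both are `x`). The division of integers rounds down, as `lam h > 0`. -/
def shift (lam : G →ₗ[ℤ] ℤ) (h x : G) : G :=
  if 0 ≤ lam x then x - (lam x / lam h) • h else x - (lam (-x) / lam h) • (-h)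

/-- `B₀` is a possible initial set, computed from the Hilbert basis `B` of `M`: either `lam`
vanishes on `U(M)` and `B₀ = B`, or it does not, some basis of `U(M⁺)` is supplemented to a basis
of `U(M)` by an element `h` of `U(M)⁺`, and `B₀` consists of the shifted elements of `B` together
with `h` and `-h`. -/
def IsInitialSet (M : AddSubmonoid G) (lam : G →ₗ[ℤ] ℤ) (B B₀ : Set G) : Prop :=
  ((∀ u ∈ units M, lam u = 0) ∧ B₀ = B) ∨
  ((∃ u ∈ units M, lam u ≠ 0) ∧
    ∃ (n : ℕ) (b : Fin n → G) (h : G),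
      IsZBasis (units (cutPos M lam)) b ∧
      h ∈ units M ∧ 0 ≤ lam h ∧
      IsZBasis (units M) (Fin.cons h b : Fin (n + 1) → G) ∧
      B₀ = shift lam h '' B ∪ {h, -h})

/-- `B` together with all nonzero sums `x + y`, where `x, y ∈ B`, `lam x > 0` and `lam y < 0`. -/
def extend (lam : G →ₗ[ℤ] ℤ) (B : Set G) : Set G :=
  B ∪ {z | ∃ x ∈ B, ∃ y ∈ B, 0 < lam x ∧ lam y < 0 ∧ x + y ≠ 0 ∧ z = x + y}

/-- `Bp i = B_i⁺` and `Bm i = B_i⁻` are the sets produced by a run of the halfspace cutting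
algorithm that starts from the Hilbert basis `B` of `M`; the set `B_i` is `Bp i ∪ Bm i`. No
assumption is made on the choices left open by the algorithm (the element `h` and the
auto-reductions). -/
structure IsRun (M : AddSubmonoid G) (lam : G →ₗ[ℤ] ℤ) (B : Set G) (Bp Bm : ℕ → Set G) :
    Prop where
  init : ∃ B₀ : Set G, IsInitialSet M lam B B₀ ∧
    Bp 0 = {x ∈ B₀ | 0 ≤ lam x} ∧ Bm 0 = {x ∈ B₀ | lam x ≤ 0}
  step_pos : ∀ i, IsAutoReduction (cutPos M lam)
    {x ∈ extend lam (Bp i ∪ Bm i) | 0 ≤ lam x} (Bp (i + 1))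
  step_neg : ∀ i, IsAutoReduction (cutNeg M lam)
    {x ∈ extend lam (Bp i ∪ Bm i) | lam x ≤ 0} (Bm (i + 1))

/-- Newly formed sums are tested against the previous sets: a new element that is
reduced by an element of `B_{i-1}⁺` (respectively `B_{i-1}⁻`) does not enter `B_i⁺`
(respectively `B_i⁻`). -/
def TestsNewAgainstOld (M : AddSubmonoid G) (lam : G →ₗ[ℤ] ℤ) (Bp Bm : ℕ → Set G) : Prop :=
  ∀ i,
    (∀ z ∈ Bp (i + 1), z ∉ Bp i ∪ Bm i → ∀ x ∈ Bp i, ¬ Reduces (cutPos M lam) x z) ∧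
    (∀ z ∈ Bm (i + 1), z ∉ Bp i ∪ Bm i → ∀ x ∈ Bm i, ¬ Reduces (cutNeg M lam) x z)

end Monoids

end HalfspaceCut

/-! Everything is proved for solution monoids of finitely many integral inequalities; the sum of the
defining forms is a grading `deg` of `M` that vanishes exactly on the units. The two halves are
exchanged by `lam ↦ -lam`, so only the positive half is treated.

Correctness. Up to units of `M⁺`, the initial elements survive every step because they are
irreducible in their halves (`exists_sub_unit`), so the current set always generates `M` modulo
those units. At a fixed point, write `z ∈ M⁺` as `p + m`, generated by the two halves. A summand `x`
of `p` with `lam x > 0` and a summand `y` of `m` with `lam y < 0` are merged: `x + y` was a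
candidate, hence was kept, is a unit, or is reduced to an element of smaller degree, to which
induction applies. Merging lowers `lam p - lam m`, so it ends (`exists_add_eq`) with `lam m = 0`,
and such an `m` is generated by the positive half as well. Minimality is the absence of mutual
reduction.

Termination. An element once present always has some current element below it. If new elements
appeared infinitely often, Dickson's lemma would give a new one reduced by an old one
(`finite_new`). From some step on the finite sets only shrink, so they stabilize. -/

namespace HalfspaceCut

section Monoids

variable {G : Type*} [AddCommGroup G]

/-! ### Polyhedral monoids, gradings and the symmetry between the two halves -/

/-- `M` is the set of solutions of finitely many homogeneous linear inequalities. -/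
def IsPolyhedral (M : AddSubmonoid G) : Prop :=
  ∃ (n : ℕ) (a : Fin n → G →+ ℤ), ∀ x, x ∈ M ↔ ∀ j, 0 ≤ a j x

/-- `deg` is a grading of `M` that is positive outside the units. -/
structure IsDegree (M : AddSubmonoid G) (deg : G →+ ℤ) : Prop where
  nonneg : ∀ x ∈ M, 0 ≤ deg x
  unit_of_eq_zero : ∀ x ∈ M, deg x = 0 → x ∈ units M

theorem mem_units {M : AddSubmonoid G} {x : G} : x ∈ units M ↔ x ∈ M ∧ -x ∈ M := Iff.rfl

theorem mem_cutPos {M : AddSubmonoid G} {lam : G →ₗ[ℤ] ℤ} {x : G} :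
    x ∈ cutPos M lam ↔ x ∈ M ∧ 0 ≤ lam x := Iff.rfl

theorem cutPos_neg (M : AddSubmonoid G) (lam : G →ₗ[ℤ] ℤ) : cutPos M (-lam) = cutNeg M lam := by
  ext x
  change (x ∈ M ∧ 0 ≤ -lam x) ↔ (x ∈ M ∧ lam x ≤ 0)
  simp

theorem cutNeg_neg (M : AddSubmonoid G) (lam : G →ₗ[ℤ] ℤ) : cutNeg M (-lam) = cutPos M lam := by
  rw [← cutPos_neg, neg_neg]

theorem mem_units_cutPos {M : AddSubmonoid G} {lam : G →ₗ[ℤ] ℤ} {x : G} :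
    x ∈ units (cutPos M lam) ↔ x ∈ units M ∧ lam x = 0 := by
  rw [mem_units, mem_units, mem_cutPos, mem_cutPos, map_neg]
  constructor
  · rintro ⟨⟨h1, h2⟩, h3, h4⟩
    exact ⟨⟨h1, h3⟩, by lia⟩
  · rintro ⟨⟨h1, h2⟩, h3⟩
    exact ⟨⟨h1, by lia⟩, h2, by lia⟩

theorem units_cutNeg (M : AddSubmonoid G) (lam : G →ₗ[ℤ] ℤ) :
    units (cutNeg M lam) = units (cutPos M lam) := by
  ext x
  rw [← cutPos_neg, mem_units_cutPos, mem_units_cutPos, LinearMap.neg_apply, neg_eq_zero]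

theorem extend_neg (lam : G →ₗ[ℤ] ℤ) (B : Set G) : extend (-lam) B = extend lam B := by
  unfold extend
  congr 1
  ext z
  simp only [LinearMap.neg_apply, Left.neg_pos_iff, Left.neg_neg_iff]
  constructor <;>
  · rintro ⟨x, hx, y, hy, h1, h2, h3, h4⟩
    exact ⟨y, hy, x, hx, h2, h1, by rwa [add_comm], by rwa [add_comm]⟩

theorem finite_extend (lam : G →ₗ[ℤ] ℤ) {B : Set G} (hB : B.Finite) : (extend lam B).Finite := by
  refine hB.union ((hB.add hB).subset ?_)
  rintro z ⟨x, hx, y, hy, -, -, -, rfl⟩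
  exact Set.add_mem_add hx hy

namespace IsPolyhedral

variable {M : AddSubmonoid G}

/-- The sum of the defining forms works: where it vanishes on `M`, every form vanishes, so the
negative is a solution too. -/
theorem exists_degree (hM : IsPolyhedral M) : ∃ deg, IsDegree M deg := by
  obtain ⟨n, a, ha⟩ := hM
  refine ⟨∑ j, a j, ?_, ?_⟩
  · intro x hx
    rw [AddMonoidHom.finsetSum_apply]
    exact Finset.sum_nonneg fun j _ => (ha x).1 hx j
  · intro x hx h0
    rw [AddMonoidHom.finsetSum_apply, Finset.sum_eq_zero_iff_of_nonneg fun j _ => (ha x).1 hx j]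
      at h0
    refine ⟨hx, (ha _).2 fun j => ?_⟩
    rw [map_neg, h0 j (Finset.mem_univ j), neg_zero]

/-- A form of Dickson's lemma. -/
theorem exists_lt_sub_mem (hM : IsPolyhedral M) (f : ℕ → G) (hf : ∀ k, f k ∈ M) :
    ∃ i j, i < j ∧ f j - f i ∈ M := by
  obtain ⟨n, a, ha⟩ := hM
  obtain ⟨i, j, hij, h⟩ := (wellQuasiOrdered_le (α := Fin n → ℕ))
    (fun k t => (a t (f k)).toNat)
  refine ⟨i, j, hij, (ha _).2 fun t => ?_⟩
  have h1 := h t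
  have h2 := (ha _).1 (hf i) t
  have h3 := (ha _).1 (hf j) t
  rw [map_sub]
  simp only at h1
  lia

theorem cutPos (hM : IsPolyhedral M) (lam : G →ₗ[ℤ] ℤ) : IsPolyhedral (cutPos M lam) := by
  obtain ⟨n, a, ha⟩ := hM
  refine ⟨n + 1, Fin.cons lam.toAddMonoidHom a, fun x => ?_⟩
  rw [Fin.forall_fin_succ, mem_cutPos, ha, and_comm]
  rfl

end IsPolyhedral

namespace IsDegree

variable {M : AddSubmonoid G} {deg : G →+ ℤ}

theorem eq_zero_of_unit (hdeg : IsDegree M deg) {x : G} (hx : x ∈ units M) : deg x = 0 := by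
  have h1 := hdeg.nonneg _ hx.1
  have h2 := hdeg.nonneg _ hx.2
  rw [map_neg] at h2
  lia

theorem pos (hdeg : IsDegree M deg) {x : G} (hx : x ∈ M) (hu : x ∉ units M) : 0 < deg x :=
  (hdeg.nonneg x hx).lt_of_ne fun h => hu (hdeg.unit_of_eq_zero x hx h.symm)

end IsDegree

/-! ### Hilbert bases: irreducibility and finiteness -/

theorem mem_closure_sup_units {M : AddSubmonoid G} {H : Set G} {x : G} :
    x ∈ AddSubmonoid.closure H ⊔ (units M).toAddSubmonoid ↔
      ∃ y ∈ AddSubmonoid.closure H, ∃ u ∈ units M, y + u = x := by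
  rw [AddSubmonoid.mem_sup]
  rfl

namespace IsHilbertBasis

variable {M : AddSubmonoid G} {B : Set G}

theorem subset (hB : IsHilbertBasis M B) : B ⊆ M := fun x hx => by
  have h : AddSubmonoid.closure B ⊔ (units M).toAddSubmonoid = M := hB.1
  have h2 : x ∈ AddSubmonoid.closure B ⊔ (units M).toAddSubmonoid :=
    AddSubmonoid.mem_sup_left (AddSubmonoid.subset_closure hx)
  rwa [h] at h2

theorem notMem_closure_diff (hB : IsHilbertBasis M B) {x : G} (hx : x ∈ B) :
    x ∉ AddSubmonoid.closure (B \ {x}) ⊔ (units M).toAddSubmonoid := by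
  intro h
  have hgen : AddSubmonoid.closure B ⊔ (units M).toAddSubmonoid = M := hB.1
  have h1 : GeneratesModUnits M (B \ {x}) := by
    refine le_antisymm ?_ ?_
    · exact (sup_le_sup_right (AddSubmonoid.closure_mono Set.sdiff_subset) _).trans hgen.le
    · conv_lhs => rw [← hgen]
      refine sup_le (AddSubmonoid.closure_le.2 fun y hy => ?_) le_sup_right
      by_cases hyx : y = x
      · rwa [hyx]
      · exact AddSubmonoid.mem_sup_left (AddSubmonoid.subset_closure ⟨hy, hyx⟩)
  exact (hB.2 h1 Set.sdiff_subset hx).2 rfl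

theorem not_unit (hB : IsHilbertBasis M B) {x : G} (hx : x ∈ B) : x ∉ units M := fun h =>
  hB.notMem_closure_diff hx (AddSubmonoid.mem_sup_right h)

/-- Degrees of summands are nonnegative, so a representation of `a` has no room for the summand `x`.
-/
theorem mem_closure_diff_of_deg_lt (hB : IsHilbertBasis M B) {deg : G →+ ℤ}
    (hdeg : IsDegree M deg) {x a : G} (ha : a ∈ M) (hlt : deg a < deg x) :
    a ∈ AddSubmonoid.closure (B \ {x}) ⊔ (units M).toAddSubmonoid := by
  have hgen : AddSubmonoid.closure B ⊔ (units M).toAddSubmonoid = M := hB.1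
  rw [← hgen] at ha
  obtain ⟨y, hy, u, hu, rfl⟩ := mem_closure_sup_units.1 ha
  rw [map_add, hdeg.eq_zero_of_unit hu, add_zero] at hlt
  refine add_mem (AddSubmonoid.mem_sup_left ?_) (AddSubmonoid.mem_sup_right hu)
  have hBM : AddSubmonoid.closure B ≤ M := AddSubmonoid.closure_le.2 hB.subset
  clear ha
  induction hy using AddSubmonoid.closure_induction with
  | mem z hz => exact AddSubmonoid.subset_closure ⟨hz, fun h => hlt.ne (by rw [h])⟩
  | zero => exact zero_mem _
  | add p q hp hq ihp ihq =>
    have h1 := hdeg.nonneg p (hBM hp)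
    have h2 := hdeg.nonneg q (hBM hq)
    rw [map_add] at hlt
    exact add_mem (ihp (by lia)) (ihq (by lia))

/-- Two non-unit summands would both have smaller degree than `x`, hence be generated without `x`,
against minimality. -/
theorem irreducible (hB : IsHilbertBasis M B) {deg : G →+ ℤ} (hdeg : IsDegree M deg) {x a b : G}
    (hx : x ∈ B) (ha : a ∈ M) (hb : b ∈ M) (hab : a + b = x) : a ∈ units M ∨ b ∈ units M := by
  by_contra! hcon
  have h1 := hdeg.pos ha hcon.1
  have h2 := hdeg.pos hb hcon.2
  have h3 : deg a + deg b = deg x := by rw [← map_add, hab]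
  apply hB.notMem_closure_diff hx
  nth_rewrite 2 [← hab]
  exact add_mem (hB.mem_closure_diff_of_deg_lt hdeg ha (by lia))
    (hB.mem_closure_diff_of_deg_lt hdeg hb (by lia))

theorem eq_of_sub_mem (hB : IsHilbertBasis M B) {deg : G →+ ℤ} (hdeg : IsDegree M deg) {x y : G}
    (hx : x ∈ B) (hy : y ∈ B) (hxy : x - y ∈ M) : x = y := by
  by_contra hne
  have h := (hB.irreducible hdeg hx (hB.subset hy) hxy (by abel)).resolve_left (hB.not_unit hy)
  apply hB.notMem_closure_diff hx
  rw [mem_closure_sup_units]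
  exact ⟨y, AddSubmonoid.subset_closure ⟨hy, fun h => hne h.symm⟩, _, h, by abel⟩

theorem finite (hB : IsHilbertBasis M B) (hM : IsPolyhedral M) : B.Finite := by
  obtain ⟨deg, hdeg⟩ := hM.exists_degree
  by_contra hinf
  have : Infinite B := Set.infinite_coe_iff.2 hinf
  obtain ⟨i, j, hij, h⟩ := hM.exists_lt_sub_mem (fun k => (Infinite.natEmbedding B k : G))
    fun k => hB.subset (Subtype.mem _)
  have h1 := hB.eq_of_sub_mem hdeg (Subtype.mem _) (Subtype.mem _) h
  exact hij.ne' ((Infinite.natEmbedding B).injective (Subtype.ext h1))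

end IsHilbertBasis

/-! ### Irreducible elements and the initial set -/

/-- `x` is a non-unit of `M` that is not a sum of two non-units. -/
def IsIrred (M : AddSubmonoid G) (x : G) : Prop :=
  x ∉ units M ∧ ∀ a ∈ M, ∀ b ∈ M, a + b = x → a ∈ units M ∨ b ∈ units M

/-- The properties of the initial set on which the algorithm relies. They are symmetric in `lam`
and `-lam`. -/
structure IsStart (M : AddSubmonoid G) (lam : G →ₗ[ℤ] ℤ) (B₀ : Set G) : Prop where
  finite : B₀.Finite
  subset : B₀ ⊆ M
  gen : M ≤ AddSubmonoid.closure B₀ ⊔ (units (cutPos M lam)).toAddSubmonoid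
  irred_pos : ∀ x ∈ B₀, 0 ≤ lam x → IsIrred (cutPos M lam) x
  irred_neg : ∀ x ∈ B₀, lam x ≤ 0 → IsIrred (cutNeg M lam) x
  unit_pos : ∀ u ∈ units M, 0 < lam u → ∃ h ∈ B₀, h ∈ units M ∧ 0 < lam h ∧ lam h ≤ lam u
  unit_neg : ∀ u ∈ units M, lam u < 0 → ∃ h ∈ B₀, h ∈ units M ∧ lam h < 0 ∧ lam u ≤ lam h

theorem IsStart.neg {M : AddSubmonoid G} {lam : G →ₗ[ℤ] ℤ} {B₀ : Set G}
    (h : IsStart M lam B₀) : IsStart M (-lam) B₀ where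
  finite := h.finite
  subset := h.subset
  gen := by rw [cutPos_neg, units_cutNeg]; exact h.gen
  irred_pos x hx hl := by
    rw [cutPos_neg]
    exact h.irred_neg x hx (by simpa using hl)
  irred_neg x hx hl := by
    rw [cutNeg_neg]
    exact h.irred_pos x hx (by simpa using hl)
  unit_pos u hu hl := by
    simpa using h.unit_neg u hu (by simpa using hl)
  unit_neg u hu hl := by
    simpa using h.unit_pos u hu (by simpa using hl)

/-- An irreducible element of `M` that is minimal with respect to the values of `lam` on the units
is irreducible in `M⁺`. -/
theorem isIrred_cutPos {M : AddSubmonoid G} {lam : G →ₗ[ℤ] ℤ} {x : G} (hx : IsIrred M x)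
    (hmin : ∀ u ∈ units M, 0 < lam u → lam x < lam u) : IsIrred (cutPos M lam) x := by
  refine ⟨fun h => hx.1 (mem_units_cutPos.1 h).1, fun a ha b hb hab => ?_⟩
  have hl : lam a + lam b = lam x := by rw [← map_add, hab]
  have ha0 := ha.2
  have hb0 := hb.2
  refine (hx.2 a ha.1 b hb.1 hab).imp (fun h => mem_units_cutPos.2 ⟨h, ?_⟩)
    fun h => mem_units_cutPos.2 ⟨h, ?_⟩
  · by_contra hne
    have := hmin a h (by lia)
    lia
  · by_contra hne
    have := hmin b h (by lia)
    lia

/-- A unit of `M` with the smallest positive value under `lam` is irreducible in `M⁺`. -/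
theorem isIrred_cutPos_of_unit {M : AddSubmonoid G} {lam : G →ₗ[ℤ] ℤ} {h : G} (hh : h ∈ units M)
    (hpos : 0 < lam h) (hmin : ∀ u ∈ units M, 0 < lam u → lam h ≤ lam u) :
    IsIrred (cutPos M lam) h := by
  refine ⟨fun h0 => hpos.ne' (mem_units_cutPos.1 h0).2, fun a ha b hb hab => ?_⟩
  have hl : lam a + lam b = lam h := by rw [← map_add, hab]
  have ha0 := ha.2
  have hb0 := hb.2
  have hau : a ∈ units M := mem_units.2 ⟨ha.1, by
    have : -a = b + -h := by rw [← hab]; abel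
    rw [this]; exact add_mem hb.1 hh.2⟩
  have hbu : b ∈ units M := mem_units.2 ⟨hb.1, by
    have : -b = a + -h := by rw [← hab]; abel
    rw [this]; exact add_mem ha.1 hh.2⟩
  by_cases h0 : lam a = 0
  · exact Or.inl (mem_units_cutPos.2 ⟨hau, h0⟩)
  · have := hmin a hau (by lia)
    exact Or.inr (mem_units_cutPos.2 ⟨hbu, by lia⟩)

theorem IsIrred.add_unit {M : AddSubmonoid G} {x u : G} (hx : IsIrred M x) (hu : u ∈ units M) :
    IsIrred M (x + u) := by
  refine ⟨fun h => hx.1 (by simpa using sub_mem h hu), fun a ha b hb hab => ?_⟩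
  refine (hx.2 a ha (b + -u) (add_mem hb hu.2) ?_).imp_right fun h => ?_
  · rw [← add_assoc, hab]; abel
  · simpa using add_mem h hu

theorem shift_spec (lam : G →ₗ[ℤ] ℤ) {h : G} (hh : 0 < lam h) (x : G) :
    ∃ k : ℤ, shift lam h x = x + k • h ∧ |lam (shift lam h x)| < lam h := by
  unfold shift
  split_ifs with hx
  · refine ⟨-(lam x / lam h), by rw [neg_smul, sub_eq_add_neg], ?_⟩
    have h1 := Int.emod_nonneg (lam x) hh.ne'
    have h2 := Int.emod_lt_of_pos (lam x) hh
    have h3 : lam (x - (lam x / lam h) • h) = lam x % lam h := by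
      rw [map_sub, map_smul, smul_eq_mul, Int.emod_def]; ring
    rw [h3, abs_lt]
    constructor <;> lia
  · refine ⟨lam (-x) / lam h, by rw [smul_neg, sub_neg_eq_add], ?_⟩
    have h1 := Int.emod_nonneg (lam (-x)) hh.ne'
    have h2 := Int.emod_lt_of_pos (lam (-x)) hh
    have h3 : lam (x - (lam (-x) / lam h) • (-h)) = -(lam (-x) % lam h) := by
      rw [map_sub, map_smul, smul_eq_mul, Int.emod_def, map_neg, map_neg]; ring
    rw [h3, abs_lt]
    constructor <;> lia

/-- If `lam` does not vanish on the units, its values there are the multiples of `lam h`. Shifting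
keeps elements irreducible in `M` and makes `|lam|` smaller than `lam h`, which is what
irreducibility in the halves needs. -/
theorem IsInitialSet.isStart {M : AddSubmonoid G} {lam : G →ₗ[ℤ] ℤ} {B B₀ : Set G}
    (hM : IsPolyhedral M) (hB : IsHilbertBasis M B) (h₀ : IsInitialSet M lam B B₀) :
    IsStart M lam B₀ := by
  obtain ⟨deg, hdeg⟩ := hM.exists_degree
  have hirr : ∀ x ∈ B, IsIrred M x := fun x hx =>
    ⟨hB.not_unit hx, fun a ha b hb hab => hB.irreducible hdeg hx ha hb hab⟩
  have hgen : AddSubmonoid.closure B ⊔ (units M).toAddSubmonoid = M := hB.1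
  rcases h₀ with ⟨hvan, rfl⟩ | ⟨⟨u₀, hu₀, hu₀'⟩, n, b, h, hb, hhu, hh0, hbh, rfl⟩
  · refine ⟨hB.finite hM, hB.subset, ?_, fun x hx _ => ?_, fun x hx _ => ?_, ?_, ?_⟩
    · conv_lhs => rw [← hgen]
      exact sup_le_sup_left (fun u hu => mem_units_cutPos.2 ⟨hu, hvan u hu⟩) _
    · exact isIrred_cutPos (hirr x hx) fun u hu h => absurd (hvan u hu) h.ne'
    · rw [← cutPos_neg]
      exact isIrred_cutPos (hirr x hx) fun u hu h => absurd (hvan u hu) (by simpa using h.ne')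
    · exact fun u hu h => absurd (hvan u hu) h.ne'
    · exact fun u hu h => absurd (hvan u hu) h.ne
  · have hdec : ∀ u ∈ units M, ∃ k : ℤ, ∃ v ∈ units (cutPos M lam), u = k • h + v := by
      intro u hu
      rw [← hbh.2, Fin.range_cons, Set.insert_eq, AddSubgroup.closure_union, hb.2,
        AddSubgroup.mem_sup] at hu
      obtain ⟨y, hy, v, hv, rfl⟩ := hu
      obtain ⟨k, rfl⟩ := AddSubgroup.mem_closure_singleton.1 hy
      exact ⟨k, v, hv, rfl⟩
    have hval : ∀ u ∈ units M, ∃ k : ℤ, lam u = k * lam h := by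
      intro u hu
      obtain ⟨k, v, hv, rfl⟩ := hdec u hu
      exact ⟨k, by rw [map_add, map_smul, (mem_units_cutPos.1 hv).2, add_zero, smul_eq_mul]⟩
    have hh : 0 < lam h := by
      refine hh0.lt_of_ne fun h0 => hu₀' ?_
      obtain ⟨k, hk⟩ := hval u₀ hu₀
      rw [hk, ← h0, mul_zero]
    have hmin : ∀ u ∈ units M, 0 < lam u → lam h ≤ lam u := by
      intro u hu hpos
      obtain ⟨k, hk⟩ := hval u hu
      rw [hk] at hpos ⊢
      have : 0 < k := pos_of_mul_pos_left hpos hh.le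
      nlinarith
    have hmin' : ∀ u ∈ units M, 0 < (-lam) u → lam h ≤ (-lam) u := fun u hu hpos => by
      have := hmin (-u) (neg_mem hu) (by simpa using hpos)
      simpa using this
    have hshift : ∀ x ∈ B, IsIrred M (shift lam h x) ∧ shift lam h x ∈ M := fun x hx => by
      obtain ⟨k, hk, -⟩ := shift_spec lam hh x
      rw [hk]
      exact ⟨(hirr x hx).add_unit (zsmul_mem hhu k),
        add_mem (hB.subset hx) (zsmul_mem hhu k : k • h ∈ units M).1⟩
    have habs : ∀ x, |lam (shift lam h x)| < lam h := fun x => (shift_spec lam hh x).choose_spec.2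
    refine ⟨((hB.finite hM).image _).union (by simp), ?_, ?_, ?_, ?_, ?_, ?_⟩
    · rintro _ (⟨x, hx, rfl⟩ | rfl | rfl)
      · exact (hshift x hx).2
      · exact hhu.1
      · exact hhu.2
    -- Both `h` and `-h` are generators, so all integral multiples of `h` are available to undo the
    -- shifts and to reach the units of `M`.
    · set N := AddSubmonoid.closure (shift lam h '' B ∪ {h, -h}) ⊔
        (units (cutPos M lam)).toAddSubmonoid with hN
      have hk : ∀ k : ℤ, k • h ∈ N := fun k => by
        have h1 : h ∈ N := AddSubmonoid.mem_sup_left (AddSubmonoid.subset_closure (by simp))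
        have h2 : -h ∈ N := AddSubmonoid.mem_sup_left (AddSubmonoid.subset_closure (by simp))
        obtain ⟨m, rfl | rfl⟩ := k.eq_nat_or_neg
        · rw [natCast_zsmul]; exact nsmul_mem h1 m
        · rw [neg_smul, natCast_zsmul, ← smul_neg]; exact nsmul_mem h2 m
      conv_lhs => rw [← hgen]
      refine sup_le (AddSubmonoid.closure_le.2 fun x hx => ?_) fun u hu => ?_
      · obtain ⟨k, hk', -⟩ := shift_spec lam hh x
        have : x = shift lam h x + (-k) • h := by rw [hk', neg_smul]; abel
        rw [this]
        exact add_mem (AddSubmonoid.mem_sup_left (AddSubmonoid.subset_closure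
          (Or.inl ⟨x, hx, rfl⟩))) (hk _)
      · obtain ⟨k, v, hv, rfl⟩ := hdec u hu
        exact add_mem (hk k) (AddSubmonoid.mem_sup_right hv)
    · rintro _ (⟨x, hx, rfl⟩ | rfl | rfl) hl
      · refine isIrred_cutPos (hshift x hx).1 fun u hu hpos => ?_
        exact (le_abs_self _).trans_lt ((habs x).trans_le (hmin u hu hpos))
      · exact isIrred_cutPos_of_unit hhu hh hmin
      · rw [map_neg] at hl; lia
    · rintro _ (⟨x, hx, rfl⟩ | rfl | rfl) hl <;> rw [← cutPos_neg]
      · refine isIrred_cutPos (hshift x hx).1 fun u hu hpos => ?_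
        exact (neg_le_abs _).trans_lt ((habs x).trans_le (hmin' u hu hpos))
      · lia
      · refine isIrred_cutPos_of_unit (neg_mem hhu) (by simpa using hh) fun u hu hpos => ?_
        simpa using hmin' u hu hpos
    · exact fun u hu hpos => ⟨h, by simp, hhu, hh, hmin u hu hpos⟩
    · intro u hu hneg
      refine ⟨-h, by simp, neg_mem hhu, by simpa using hh, ?_⟩
      have := hmin' u hu (by simpa using hneg)
      rw [LinearMap.neg_apply] at this
      rw [map_neg]; lia

/-! ### Fixed points of the algorithm yield Hilbert bases -/

/-- `P` and `Q` are the two halves of a set on which a step of the algorithm has no effect. The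
conditions are symmetric in `lam` and `-lam`. -/
structure IsStable (M : AddSubmonoid G) (lam : G →ₗ[ℤ] ℤ) (P Q : Set G) : Prop where
  pos : IsAutoReduction (cutPos M lam) {x ∈ extend lam (P ∪ Q) | 0 ≤ lam x} P
  neg : IsAutoReduction (cutNeg M lam) {x ∈ extend lam (P ∪ Q) | lam x ≤ 0} Q
  subset : P ∪ Q ⊆ M
  gen : M ≤ AddSubmonoid.closure (P ∪ Q) ⊔ (units (cutPos M lam)).toAddSubmonoid
  unit_pos : ∀ u ∈ units M, 0 < lam u → ∀ x ∈ P, lam x ≤ lam u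
  unit_neg : ∀ u ∈ units M, lam u < 0 → ∀ x ∈ Q, lam u ≤ lam x

/-- The submonoid of `M⁺` generated by `P` and the units of `M⁺`. -/
abbrev genPos (M : AddSubmonoid G) (lam : G →ₗ[ℤ] ℤ) (P : Set G) : AddSubmonoid G :=
  AddSubmonoid.closure P ⊔ (units (cutPos M lam)).toAddSubmonoid

theorem genPos_le {M : AddSubmonoid G} {lam : G →ₗ[ℤ] ℤ} {P : Set G} (hP : P ⊆ cutPos M lam) :
    genPos M lam P ≤ cutPos M lam :=
  sup_le (AddSubmonoid.closure_le.2 hP) fun _ hu => hu.1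

theorem mem_genPos {M : AddSubmonoid G} {lam : G →ₗ[ℤ] ℤ} {P : Set G} {x : G} (hx : x ∈ P) :
    x ∈ genPos M lam P :=
  AddSubmonoid.mem_sup_left (AddSubmonoid.subset_closure hx)

theorem exists_pos_of_mem_genPos {M : AddSubmonoid G} {lam : G →ₗ[ℤ] ℤ} {P : Set G} {p : G}
    (hp : p ∈ genPos M lam P) (hpos : 0 < lam p) :
    ∃ x ∈ P, 0 < lam x ∧ ∃ q ∈ genPos M lam P, p = x + q := by
  obtain ⟨y, hy, u, hu, rfl⟩ := mem_closure_sup_units.1 hp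
  rw [map_add, (mem_units_cutPos.1 hu).2, add_zero] at hpos
  suffices h : ∃ x ∈ P, 0 < lam x ∧ ∃ q ∈ genPos M lam P, y = x + q by
    obtain ⟨x, hx, hx0, q, hq, rfl⟩ := h
    exact ⟨x, hx, hx0, q + u, add_mem hq (AddSubmonoid.mem_sup_right hu), by abel⟩
  clear hp
  induction hy using AddSubmonoid.closure_induction with
  | mem z hz => exact ⟨z, hz, hpos, 0, zero_mem _, by simp⟩
  | zero => simp at hpos
  | add a b ha hb iha ihb =>
    rw [map_add] at hpos
    by_cases h : 0 < lam a
    · obtain ⟨x, hx, hx0, q, hq, rfl⟩ := iha h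
      exact ⟨x, hx, hx0, q + b, add_mem hq (AddSubmonoid.mem_sup_left hb), by abel⟩
    · obtain ⟨x, hx, hx0, q, hq, rfl⟩ := ihb (by lia)
      exact ⟨x, hx, hx0, q + a, add_mem hq (AddSubmonoid.mem_sup_left ha), by abel⟩

namespace IsStable

variable {M : AddSubmonoid G} {lam : G →ₗ[ℤ] ℤ} {P Q : Set G}

theorem symm (hS : IsStable M lam P Q) : IsStable M (-lam) Q P where
  pos := by simpa [cutPos_neg, extend_neg, Set.union_comm] using hS.neg
  neg := by simpa [cutNeg_neg, extend_neg, Set.union_comm] using hS.pos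
  subset := by rw [Set.union_comm]; exact hS.subset
  gen := by rw [cutPos_neg, units_cutNeg, Set.union_comm]; exact hS.gen
  unit_pos u hu hl x hx := by
    simpa using hS.unit_neg u hu (by simpa using hl) x hx
  unit_neg u hu hl x hx := by
    simpa using hS.unit_pos u hu (by simpa using hl) x hx

theorem subset_cutPos (hS : IsStable M lam P Q) : P ⊆ cutPos M lam := fun _ hx =>
  ⟨hS.subset (Or.inl hx), (hS.pos.subset hx).2⟩

theorem subset_cutNeg (hS : IsStable M lam P Q) : Q ⊆ cutNeg M lam := fun _ hx =>
  ⟨hS.subset (Or.inr hx), (hS.neg.subset hx).2⟩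

/-- A discarded candidate is a unit or has a reducer `v`. Induction on the degree applies to `e - v`
only if `deg v > 0`, so `v` must be a non-unit of `M`, not merely of `M⁺`; `hred` supplies this. -/
theorem mem_genPos_of_mem_extend (hS : IsStable M lam P Q) {deg : G →+ ℤ} (hdeg : IsDegree M deg)
    {n : ℤ} (ih : ∀ z ∈ cutPos M lam, deg z < n → z ∈ genPos M lam P) {e : G}
    (he : e ∈ extend lam (P ∪ Q)) (hpos : 0 ≤ lam e) (hen : deg e ≤ n)
    (hred : ∀ v ∈ P, e - v ∈ cutPos M lam → v ∉ units M) : e ∈ genPos M lam P := by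
  by_cases heP : e ∈ P
  · exact mem_genPos heP
  · rcases hS.pos.discarded e ⟨he, hpos⟩ heP with hu | ⟨v, hv, -, -, hev⟩
    · exact AddSubmonoid.mem_sup_right hu
    · have h1 := hdeg.pos (hS.subset_cutPos hv).1 (hred v hv hev)
      have h2 : e - v ∈ genPos M lam P := ih _ hev (by rw [map_sub]; lia)
      simpa using add_mem h2 (mem_genPos (M := M) (lam := lam) hv)

theorem add_mem_genPos (hS : IsStable M lam P Q) {deg : G →+ ℤ} (hdeg : IsDegree M deg)
    {n : ℤ} (ih : ∀ z ∈ cutPos M lam, deg z < n → z ∈ genPos M lam P) {x y : G}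
    (hx : x ∈ P) (hy : y ∈ Q) (hx0 : 0 < lam x) (hy0 : lam y < 0) (hxy : 0 ≤ lam (x + y))
    (hn : deg (x + y) ≤ n) : x + y ∈ genPos M lam P := by
  by_cases h0 : x + y = 0
  · rw [h0]; exact zero_mem _
  · refine hS.mem_genPos_of_mem_extend hdeg ih
      -- A reducer `v` that is a unit of `M` would satisfy `lam v ≥ lam x > lam (x + y)`, so `x + y
      -- - v` would leave `M⁺`.
      (Or.inr ⟨x, Or.inl hx, y, Or.inr hy, hx0, hy0, h0, rfl⟩) hxy hn fun v hv hsub hvu => ?_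
    have h1 := (hS.subset_cutPos hv).2
    have h2 : lam v ≠ 0 := fun h => hS.pos.not_unit v hv (mem_units_cutPos.2 ⟨hvu, h⟩)
    have h3 := hS.unit_pos v hvu (by lia) x hx
    have h4 := hsub.2
    rw [map_sub, map_add] at h4
    lia

/-- Values of `lam` on `Q` are nonpositive, so every summand from `Q` has value zero and is itself a
candidate for the positive half. -/
theorem mem_genPos_of_eq_zero (hS : IsStable M lam P Q) {deg : G →+ ℤ} (hdeg : IsDegree M deg)
    {n : ℤ} (ih : ∀ z ∈ cutPos M lam, deg z < n → z ∈ genPos M lam P) {m : G}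
    (hm : m ∈ genPos M (-lam) Q) (hm0 : lam m = 0) (hn : deg m ≤ n) : m ∈ genPos M lam P := by
  obtain ⟨y, hy, u, hu, rfl⟩ := mem_closure_sup_units.1 hm
  rw [cutPos_neg, units_cutNeg] at hu
  refine add_mem ?_ (AddSubmonoid.mem_sup_right hu)
  rw [map_add, (mem_units_cutPos.1 hu).2, add_zero] at hm0
  rw [map_add, hdeg.eq_zero_of_unit (mem_units_cutPos.1 hu).1, add_zero] at hn
  have hle : AddSubmonoid.closure Q ≤ cutNeg M lam := AddSubmonoid.closure_le.2 hS.subset_cutNeg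
  clear hm hu u
  induction hy using AddSubmonoid.closure_induction with
  | mem z hz =>
    refine hS.mem_genPos_of_mem_extend hdeg ih (Or.inl (Or.inr hz)) hm0.ge hn
      fun v hv hsub hvu => hS.pos.not_unit v hv (mem_units_cutPos.2 ⟨hvu, ?_⟩)
    have h1 := (hS.subset_cutPos hv).2
    have h2 := hsub.2
    rw [map_sub] at h2
    lia
  | zero => exact zero_mem _
  | add a b ha hb iha ihb =>
    have h1 := (hle ha).2
    have h2 := (hle hb).2
    have h3 := hdeg.nonneg a (hle ha).1
    have h4 := hdeg.nonneg b (hle hb).1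
    rw [map_add] at hm0 hn
    exact add_mem (iha (by lia) (by lia)) (ihb (by lia) (by lia))

/-- Cancellation of opposite signs in a sum of elements of `P` and elements of `Q`. -/
theorem exists_add_eq (hS : IsStable M lam P Q) {deg : G →+ ℤ} (hdeg : IsDegree M deg) {n : ℤ}
    (ihp : ∀ z ∈ cutPos M lam, deg z < n → z ∈ genPos M lam P)
    (ihm : ∀ z ∈ cutPos M (-lam), deg z < n → z ∈ genPos M (-lam) Q) (k : ℕ) :
    ∀ p ∈ genPos M lam P, ∀ m ∈ genPos M (-lam) Q, deg (p + m) ≤ n → lam p - lam m ≤ k →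
      ∃ p' ∈ genPos M lam P, ∃ m' ∈ genPos M (-lam) Q,
        p' + m' = p + m ∧ (lam p' = 0 ∨ lam m' = 0) := by
  have hleP := genPos_le hS.subset_cutPos
  have hleQ := genPos_le hS.symm.subset_cutPos
  induction k with
  | zero =>
    intro p hp m hm _ hk
    have h1 := (hleP hp).2
    have h2 := (hleQ hm).2
    rw [LinearMap.neg_apply] at h2
    exact ⟨p, hp, m, hm, rfl, Or.inl (by lia)⟩
  | succ k ihk =>
    intro p hp m hm hn hk
    have h1 := (hleP hp).2
    have h2 := (hleQ hm).2
    by_cases hp0 : lam p = 0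
    · exact ⟨p, hp, m, hm, rfl, Or.inl hp0⟩
    by_cases hm0 : lam m = 0
    · exact ⟨p, hp, m, hm, rfl, Or.inr hm0⟩
    rw [LinearMap.neg_apply] at h2
    obtain ⟨x, hx, hx0, q, hq, rfl⟩ := exists_pos_of_mem_genPos hp (by lia)
    obtain ⟨y, hy, hy0, r, hr, rfl⟩ := exists_pos_of_mem_genPos hm
      (by rw [LinearMap.neg_apply]; lia)
    rw [LinearMap.neg_apply] at hy0
    have h3 := hdeg.nonneg q (hleP hq).1
    have h4 := hdeg.nonneg r (hleQ hr).1
    have hxy : deg (x + y) ≤ n := by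
      simp only [map_add] at hn ⊢
      lia
    simp only [map_add] at hk
    have hk' := hk
    push_cast at hk'
    -- The sum `x + y` joins the half given by its sign; `lam p - lam m` drops by `-2 * lam y` or `2
    -- * lam x`, so by at least 2.
    rcases le_total 0 (lam (x + y)) with h | h
    · have he := hS.add_mem_genPos hdeg ihp hx hy hx0 (by lia) h hxy
      obtain ⟨p', hp', m', hm', heq, h0⟩ := ihk (x + y + q) (add_mem he hq) r hr
        (by rwa [show x + y + q + r = x + q + (y + r) by abel]) (by simp only [map_add]; lia)
      exact ⟨p', hp', m', hm', by rw [heq]; abel, h0⟩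
    · have he := hS.symm.add_mem_genPos hdeg ihm hy hx (by rw [LinearMap.neg_apply]; lia)
        (by rw [LinearMap.neg_apply]; lia)
        (by rw [LinearMap.neg_apply, add_comm y x]; lia) (by rwa [add_comm y x])
      obtain ⟨p', hp', m', hm', heq, h0⟩ := ihk q hq (y + x + r) (add_mem he hr)
        (by rwa [show q + (y + x + r) = x + q + (y + r) by abel]) (by simp only [map_add]; lia)
      exact ⟨p', hp', m', hm', by rw [heq]; abel, h0⟩

theorem exists_add_of_mem (hS : IsStable M lam P Q) {z : G} (hz : z ∈ M) :
    ∃ p ∈ genPos M lam P, ∃ m ∈ genPos M (-lam) Q, p + m = z := by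
  obtain ⟨y, hy, u, hu, rfl⟩ := mem_closure_sup_units.1 (hS.gen hz)
  rw [AddSubmonoid.closure_union, AddSubmonoid.mem_sup] at hy
  obtain ⟨p, hp, m, hm, rfl⟩ := hy
  exact ⟨p + u, add_mem (AddSubmonoid.mem_sup_left hp) (AddSubmonoid.mem_sup_right hu), m,
    AddSubmonoid.mem_sup_left hm, by abel⟩

theorem mem_genPos_of_ih (hS : IsStable M lam P Q) {deg : G →+ ℤ} (hdeg : IsDegree M deg) {n : ℤ}
    (ihp : ∀ z ∈ cutPos M lam, deg z < n → z ∈ genPos M lam P)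
    (ihm : ∀ z ∈ cutPos M (-lam), deg z < n → z ∈ genPos M (-lam) Q) {z : G}
    (hz : z ∈ cutPos M lam) (hn : deg z ≤ n) : z ∈ genPos M lam P := by
  obtain ⟨p, hp, m, hm, rfl⟩ := hS.exists_add_of_mem hz.1
  obtain ⟨p', hp', m', hm', heq, h0⟩ := hS.exists_add_eq hdeg ihp ihm (lam p - lam m).toNat p hp
    m hm hn (Int.self_le_toNat _)
  have h1 := (genPos_le hS.symm.subset_cutPos hm').2
  have h2 := hdeg.nonneg _ (genPos_le hS.subset_cutPos hp').1
  have h3 := hz.2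
  rw [← heq] at h3 hn ⊢
  rw [map_add] at h3 hn
  rw [LinearMap.neg_apply] at h1
  -- As `lam p' + lam m' ≥ 0` and `lam m' ≤ 0`, either alternative in `h0` forces `lam m' = 0`.
  exact add_mem hp' (hS.mem_genPos_of_eq_zero hdeg ihp hm' (by lia) (by lia))

/-- Both halves go through one induction on the degree, since merging may produce an element of
either half. -/
theorem mem_genPos_of_mem_cutPos (hS : IsStable M lam P Q) {deg : G →+ ℤ} (hdeg : IsDegree M deg)
    (n : ℕ) : (∀ z ∈ cutPos M lam, deg z < n → z ∈ genPos M lam P) ∧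
      (∀ z ∈ cutPos M (-lam), deg z < n → z ∈ genPos M (-lam) Q) := by
  induction n with
  | zero =>
    constructor <;> intro z hz hn <;> have := hdeg.nonneg z hz.1 <;> push_cast at hn <;> lia
  | succ n ih =>
    constructor
    · intro z hz hn
      exact hS.mem_genPos_of_ih hdeg ih.1 ih.2 hz (by push_cast at hn; lia)
    · intro z hz hn
      refine hS.symm.mem_genPos_of_ih hdeg ih.2 ?_ hz (by push_cast at hn; lia)
      rw [neg_neg]
      exact ih.1

theorem isHilbertBasis_pos (hM : IsPolyhedral M) (hS : IsStable M lam P Q) :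
    IsHilbertBasis (cutPos M lam) P := by
  obtain ⟨deg, hdeg⟩ := hM.exists_degree
  refine ⟨le_antisymm (genPos_le hS.subset_cutPos) fun z hz =>
    (hS.mem_genPos_of_mem_cutPos hdeg ((deg z).toNat + 1)).1 z hz (by push_cast; lia), ?_⟩
  intro H hH hHP x hx
  by_contra hxH
  have hxg : x ∈ AddSubmonoid.closure H ⊔ (units (cutPos M lam)).toAddSubmonoid := by
    rw [show _ = cutPos M lam from hH]; exact hS.subset_cutPos hx
  obtain ⟨y, hy, u, hu, rfl⟩ := mem_closure_sup_units.1 hxg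
  have hle : AddSubmonoid.closure H ≤ cutPos M lam :=
    AddSubmonoid.closure_le.2 (hHP.trans hS.subset_cutPos)
  -- If `x` is not in `H`, a summand `v` from `H` reduces it, and `v` also lies in the auto-reduced
  -- set `P`.
  have hcase : y = 0 ∨ ∃ v ∈ H, y - v ∈ cutPos M lam := by
    clear hxg hx hxH
    induction hy using AddSubmonoid.closure_induction with
    | mem z hz => exact Or.inr ⟨z, hz, by simp⟩
    | zero => exact Or.inl rfl
    | add a b ha hb iha ihb =>
      rcases iha with rfl | ⟨v, hv, hav⟩
      · simpa using ihb
      · refine Or.inr ⟨v, hv, ?_⟩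
        rw [add_sub_right_comm]
        exact add_mem hav (hle hb)
  rcases hcase with rfl | ⟨v, hv, hyv⟩
  · exact hS.pos.not_unit _ hx (by simpa using hu)
  · refine hS.pos.not_reduced _ hx v (hHP hv) ⟨hS.pos.not_unit v (hHP hv), ?_, ?_⟩
    · rintro rfl
      exact hxH hv
    · rw [add_sub_right_comm]
      exact add_mem hyv hu.1

end IsStable

/-! ### Runs: invariants and termination -/

/-- A run of the algorithm from a given initial set. -/
structure IsRunFrom (M : AddSubmonoid G) (lam : G →ₗ[ℤ] ℤ) (B₀ : Set G) (Bp Bm : ℕ → Set G) :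
    Prop where
  start : IsStart M lam B₀
  zero_pos : Bp 0 = {x ∈ B₀ | 0 ≤ lam x}
  zero_neg : Bm 0 = {x ∈ B₀ | lam x ≤ 0}
  step_pos : ∀ i, IsAutoReduction (cutPos M lam)
    {x ∈ extend lam (Bp i ∪ Bm i) | 0 ≤ lam x} (Bp (i + 1))
  step_neg : ∀ i, IsAutoReduction (cutNeg M lam)
    {x ∈ extend lam (Bp i ∪ Bm i) | lam x ≤ 0} (Bm (i + 1))

namespace IsRunFrom

variable {M : AddSubmonoid G} {lam : G →ₗ[ℤ] ℤ} {B₀ : Set G} {Bp Bm : ℕ → Set G}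

theorem symm (hR : IsRunFrom M lam B₀ Bp Bm) : IsRunFrom M (-lam) B₀ Bm Bp where
  start := hR.start.neg
  zero_pos := by simpa using hR.zero_neg
  zero_neg := by simpa using hR.zero_pos
  step_pos i := by simpa [cutPos_neg, extend_neg, Set.union_comm] using hR.step_neg i
  step_neg i := by simpa [cutNeg_neg, extend_neg, Set.union_comm] using hR.step_pos i

theorem subset (hR : IsRunFrom M lam B₀ Bp Bm) (i : ℕ) : Bp i ∪ Bm i ⊆ M := by
  induction i with
  | zero =>
    rw [hR.zero_pos, hR.zero_neg]
    rintro x (hx | hx) <;> exact hR.start.subset hx.1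
  | succ i ih =>
    have h : extend lam (Bp i ∪ Bm i) ⊆ M := by
      rintro z (hz | ⟨x, hx, y, hy, -, -, -, rfl⟩)
      · exact ih hz
      · exact add_mem (ih hx) (ih hy)
    rintro x (hx | hx)
    · exact h ((hR.step_pos i).subset hx).1
    · exact h ((hR.step_neg i).subset hx).1

theorem subset_cutPos (hR : IsRunFrom M lam B₀ Bp Bm) (i : ℕ) : Bp i ⊆ cutPos M lam := by
  intro x hx
  refine ⟨hR.subset i (Or.inl hx), ?_⟩
  cases i with
  | zero => rw [hR.zero_pos] at hx; exact hx.2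
  | succ i => exact ((hR.step_pos i).subset hx).2

theorem mem_step (hR : IsRunFrom M lam B₀ Bp Bm) {i : ℕ} {x : G} (hx : x ∈ Bp i) :
    x ∈ {x ∈ extend lam (Bp i ∪ Bm i) | 0 ≤ lam x} :=
  ⟨Or.inl (Or.inl hx), (hR.subset_cutPos i hx).2⟩

theorem not_unit (hR : IsRunFrom M lam B₀ Bp Bm) (i : ℕ) :
    ∀ x ∈ Bp i, x ∉ units (cutPos M lam) := by
  cases i with
  | zero =>
    rw [hR.zero_pos]
    exact fun x hx => (hR.start.irred_pos x hx.1 hx.2).1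
  | succ i => exact (hR.step_pos i).not_unit

theorem finite (hR : IsRunFrom M lam B₀ Bp Bm) (i : ℕ) : (Bp i ∪ Bm i).Finite := by
  induction i with
  | zero =>
    refine hR.start.finite.subset ?_
    rw [hR.zero_pos, hR.zero_neg]
    rintro x (hx | hx) <;> exact hx.1
  | succ i ih =>
    refine (finite_extend lam ih).subset ?_
    rintro x (hx | hx)
    · exact ((hR.step_pos i).subset hx).1
    · exact ((hR.step_neg i).subset hx).1

/-- Up to units, the elements of the initial set survive all steps. -/
theorem exists_sub_unit (hR : IsRunFrom M lam B₀ Bp Bm) {x : G} (hx : x ∈ B₀) (hpos : 0 ≤ lam x)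
    (i : ℕ) : ∃ y ∈ Bp i, y - x ∈ units (cutPos M lam) := by
  induction i with
  | zero =>
    refine ⟨x, ?_, by simp⟩
    rw [hR.zero_pos]
    exact ⟨hx, hpos⟩
  | succ i ih =>
    obtain ⟨y, hy, hyx⟩ := ih
    by_cases hy' : y ∈ Bp (i + 1)
    · exact ⟨y, hy', hyx⟩
    · rcases (hR.step_pos i).discarded y (hR.mem_step hy) hy' with hu | ⟨w, hw, hwu, -, hyw⟩
      · exact absurd hu (hR.not_unit i y hy)
      -- `y` is irreducible like `x`, so its reducer `w` differs from it by a unit and can take its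
      -- place.
      · have hirr := (hR.start.irred_pos x hx hpos).add_unit hyx
        rw [add_sub_cancel] at hirr
        have h := (hirr.2 w (hR.subset_cutPos _ hw) _ hyw (by abel)).resolve_left hwu
        exact ⟨w, hw, by simpa using sub_mem hyx h⟩

theorem gen (hR : IsRunFrom M lam B₀ Bp Bm) (i : ℕ) :
    M ≤ AddSubmonoid.closure (Bp i ∪ Bm i) ⊔ (units (cutPos M lam)).toAddSubmonoid := by
  refine hR.start.gen.trans (sup_le (AddSubmonoid.closure_le.2 fun x hx => ?_) le_sup_right)
  rcases le_total 0 (lam x) with h | h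
  · obtain ⟨y, hy, hyx⟩ := hR.exists_sub_unit hx h i
    exact mem_closure_sup_units.2 ⟨y, AddSubmonoid.subset_closure (Or.inl hy), _, neg_mem hyx,
      by abel⟩
  · obtain ⟨y, hy, hyx⟩ := hR.symm.exists_sub_unit hx (by simpa using h) i
    rw [cutPos_neg, units_cutNeg] at hyx
    exact mem_closure_sup_units.2 ⟨y, AddSubmonoid.subset_closure (Or.inr hy), _, neg_mem hyx,
      by abel⟩

/-- The smallest positive unit survives up to units of `M⁺` as some `y`. As `-y ∈ M`, this `y`
reduces every element of `M⁺` with a larger value of `lam`. -/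
theorem le_of_unit (hR : IsRunFrom M lam B₀ Bp Bm) (i : ℕ) {u x : G} (hu : u ∈ units M)
    (hpos : 0 < lam u) (hx : x ∈ Bp (i + 1)) : lam x ≤ lam u := by
  obtain ⟨h, hh, hhu, hh0, hle⟩ := hR.start.unit_pos u hu hpos
  obtain ⟨y, hy, hyh⟩ := hR.exists_sub_unit hh hh0.le (i + 1)
  rw [mem_units_cutPos, map_sub] at hyh
  by_contra! hlt
  refine (hR.step_pos i).not_reduced x hx y hy ⟨hR.not_unit _ y hy, ?_, ?_, ?_⟩
  · rintro rfl
    lia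
  · have h1 : -y ∈ M := by
      have : -y = -(y - h) + -h := by abel
      rw [this]
      exact add_mem hyh.1.2 hhu.2
    rw [sub_eq_add_neg]
    exact add_mem (hR.subset_cutPos _ hx).1 h1
  · rw [map_sub]
    lia

theorem isStable (hR : IsRunFrom M lam B₀ Bp Bm) {i : ℕ}
    (heq : Bp (i + 1) ∪ Bm (i + 1) = Bp i ∪ Bm i) :
    IsStable M lam (Bp (i + 1)) (Bm (i + 1)) where
  pos := by rw [heq]; exact hR.step_pos i
  neg := by rw [heq]; exact hR.step_neg i
  subset := hR.subset _
  gen := hR.gen _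
  unit_pos _ hu hpos _ hx := hR.le_of_unit i hu hpos hx
  unit_neg u hu hneg x hx := by
    simpa using hR.symm.le_of_unit i hu (by simpa using hneg) hx

/-- A discarded element passes its role to its reducer, and the differences add up inside `M⁺`. -/
theorem exists_sub_mem (hR : IsRunFrom M lam B₀ Bp Bm) {i j : ℕ} (hij : j ≤ i) {y : G}
    (hy : y ∈ Bp j) : ∃ w ∈ Bp i, y - w ∈ cutPos M lam := by
  induction i, hij using Nat.le_induction with
  | base => exact ⟨y, hy, by simp⟩
  | succ i _ ih =>
    obtain ⟨w, hw, hyw⟩ := ih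
    by_cases hw' : w ∈ Bp (i + 1)
    · exact ⟨w, hw', hyw⟩
    · rcases (hR.step_pos i).discarded w (hR.mem_step hw) hw' with hu | ⟨v, hv, -, -, hwv⟩
      · exact absurd hu (hR.not_unit i w hw)
      · exact ⟨v, hv, by simpa using add_mem hyw hwv⟩

/-- New elements appear in the positive halves in only finitely many steps. -/
theorem finite_new (hM : IsPolyhedral M) (hR : IsRunFrom M lam B₀ Bp Bm)
    (hT : ∀ i, ∀ z ∈ Bp (i + 1), z ∉ Bp i ∪ Bm i → ∀ x ∈ Bp i, ¬ Reduces (cutPos M lam) x z) :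
    {i | ∃ z ∈ Bp (i + 1), z ∉ Bp i ∪ Bm i}.Finite := by
  by_contra hinf
  obtain ⟨s, hs⟩ : ∃ s : ℕ ↪o ℕ, ∀ k, s k ∈ {i | ∃ z ∈ Bp (i + 1), z ∉ Bp i ∪ Bm i} :=
    ⟨OrderEmbedding.ofStrictMono _ (Nat.nth_strictMono hinf), fun k => Nat.nth_mem_of_infinite hinf k⟩
  choose z hz hnew using hs
  obtain ⟨k, l, hkl, h⟩ := (hM.cutPos lam).exists_lt_sub_mem z
    fun k => hR.subset_cutPos _ (hz k)
  -- `z k` appears at index `s k + 1 ≤ s l`, so its successor `w` belongs to the old set against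
  -- which `z l` is tested.
  obtain ⟨w, hw, hzw⟩ := hR.exists_sub_mem (Nat.succ_le_of_lt (s.strictMono hkl)) (hz k)
  refine hT _ _ (hz l) (hnew l) w hw ⟨hR.not_unit _ w hw, ?_, by simpa using add_mem h hzw⟩
  rintro rfl
  exact hnew l (Or.inl hw)

theorem exists_eq (hM : IsPolyhedral M) (hR : IsRunFrom M lam B₀ Bp Bm)
    (hT : TestsNewAgainstOld M lam Bp Bm) :
    ∃ i, Bp (i + 1) ∪ Bm (i + 1) = Bp i ∪ Bm i := by
  have h1 := hR.finite_new hM fun i => (hT i).1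
  have h2 := hR.symm.finite_new hM fun i => by
    rw [cutPos_neg, Set.union_comm]
    exact (hT i).2
  obtain ⟨N, hN⟩ := (h1.union h2).bddAbove
  have hsub : ∀ i, N < i → Bp (i + 1) ∪ Bm (i + 1) ⊆ Bp i ∪ Bm i := by
    intro i hi x hx
    by_contra hnew
    refine hi.not_ge (hN ?_)
    rcases hx with hx | hx
    · exact Or.inl ⟨x, hx, hnew⟩
    · exact Or.inr ⟨x, hx, by rwa [Set.union_comm]⟩
  by_contra! hne
  -- Beyond `N` the sets decrease; without a repetition their cardinalities would fall forever.
  refine not_strictAnti_of_wellFoundedLT (fun k => (Bp (N + 1 + k) ∪ Bm (N + 1 + k)).ncard)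
    (strictAnti_nat_of_succ_lt fun k => ?_)
  exact Set.ncard_lt_ncard ((hsub _ (by lia)).ssubset_of_ne (hne _)) (hR.finite _)

end IsRunFrom

end Monoids

/-! ### Rational cones and the main theorem -/

/-- Clearing denominators in the defining inequalities of a rational cone. -/
theorem IsRationalCone.isPolyhedral {d : ℕ} {C : PointedCone ℝ (Fin d → ℝ)}
    (hC : IsRationalCone C) : IsPolyhedral (latticePoints C) := by
  obtain ⟨S, hS⟩ := hC
  have hint : ∀ a : Fin d → ℚ, ∃ f : (Fin d → ℤ) →+ ℤ, ∀ x : Fin d → ℤ,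
      0 ≤ f x ↔ 0 ≤ ∑ i, (a i : ℝ) * (x i : ℝ) := by
    intro a
    have hpos : (0 : ℝ) < ((∏ i, (a i).den : ℕ) : ℝ) :=
      Nat.cast_pos.2 (Finset.prod_pos fun i _ => (a i).pos)
    have hc : ∀ i, ∃ c : ℤ, (c : ℝ) = ((∏ i, (a i).den : ℕ) : ℝ) * (a i : ℝ) := by
      intro i
      obtain ⟨k, hk⟩ := Finset.dvd_prod_of_mem (fun i => (a i).den) (Finset.mem_univ i)
      refine ⟨(a i).num * k, ?_⟩
      have h : ((a i).num : ℝ) = (a i : ℝ) * ((a i).den : ℝ) := by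
        exact_mod_cast (Rat.mul_den_eq_num (a i)).symm
      rw [hk]
      push_cast
      rw [h]
      ring
    choose c hc using hc
    refine ⟨∑ i, c i • Pi.evalAddMonoidHom (fun _ => ℤ) i, fun x => ?_⟩
    have hval : (((∑ i, c i • Pi.evalAddMonoidHom (fun _ => ℤ) i) x : ℤ) : ℝ) =
        ((∏ i, (a i).den : ℕ) : ℝ) * ∑ i, (a i : ℝ) * (x i : ℝ) := by
      rw [AddMonoidHom.finsetSum_apply, Int.cast_sum, Finset.mul_sum]
      refine Finset.sum_congr rfl fun i _ => ?_
      rw [← mul_assoc, ← hc, AddMonoidHom.smul_apply, smul_eq_mul, Int.cast_mul,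
        Pi.evalAddMonoidHom_apply]
    rw [← Int.cast_nonneg_iff (R := ℝ), hval, mul_nonneg_iff_of_pos_left hpos]
  choose f hf using hint
  refine ⟨S.card, fun j => f (S.equivFin.symm j), fun x => ?_⟩
  have hx : x ∈ latticePoints C ↔ ∀ a ∈ S, 0 ≤ ∑ i, (a i : ℝ) * (x i : ℝ) := hS _
  rw [hx]
  constructor
  · intro h j
    exact (hf _ x).2 (h _ (Subtype.mem _))
  · intro h a ha
    have := h (S.equivFin ⟨a, ha⟩)
    simp only [Equiv.symm_apply_apply] at this
    exact (hf a x).1 this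

end HalfspaceCut

theorem mainTheorem1 {d : ℕ} (C : PointedCone ℝ (Fin d → ℝ))
    (hC : HalfspaceCut.IsRationalCone C) (lam : (Fin d → ℤ) →ₗ[ℤ] ℤ) (B : Set (Fin d → ℤ))
    (hB : HalfspaceCut.IsHilbertBasis (HalfspaceCut.latticePoints C) B)
    (Bp Bm : ℕ → Set (Fin d → ℤ))
    (hrun : HalfspaceCut.IsRun (HalfspaceCut.latticePoints C) lam B Bp Bm) :
    (HalfspaceCut.TestsNewAgainstOld (HalfspaceCut.latticePoints C) lam Bp Bm →
      ∃ i, 1 ≤ i ∧ Bp i ∪ Bm i = Bp (i - 1) ∪ Bm (i - 1)) ∧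
    (∀ i, 1 ≤ i → Bp i ∪ Bm i = Bp (i - 1) ∪ Bm (i - 1) →
      HalfspaceCut.IsHilbertBasis
        (HalfspaceCut.cutPos (HalfspaceCut.latticePoints C) lam) (Bp i) ∧
      HalfspaceCut.IsHilbertBasis
        (HalfspaceCut.cutNeg (HalfspaceCut.latticePoints C) lam) (Bm i)) := by
  have hM := hC.isPolyhedral
  obtain ⟨B₀, h₀, hp, hm⟩ := hrun.init
  have hR : HalfspaceCut.IsRunFrom (HalfspaceCut.latticePoints C) lam B₀ Bp Bm :=
    ⟨h₀.isStart hM hB, hp, hm, hrun.step_pos, hrun.step_neg⟩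
  refine ⟨fun hT => ?_, fun i hi heq => ?_⟩
  · obtain ⟨i, hi⟩ := hR.exists_eq hM hT
    exact ⟨i + 1, by lia, hi⟩
  · obtain ⟨i, rfl⟩ := Nat.exists_eq_add_of_le' hi
    have hS := hR.isStable heq
    refine ⟨hS.isHilbertBasis_pos hM, ?_⟩
    rw [← HalfspaceCut.cutPos_neg]
    exact hS.symm.isHilbertBasis_pos hM
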